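/- Conventions. HTop is the category of topological spaces and homotopy classes of continuous maps (H-maps); a polyhedron is the carrier $|K|$ of a simplicial complex $K$ with the weak topology, and $\dim |K|\le n$ means that every simplex of $K$ has dimension $\le n$; HPol is the full subcategory of HTop on the spaces having the homotopy type of a polyhedron. A morphism $f$ of HPol factors through a polyhedron $P$ if $f=v\circ u$ for some H-maps $u$ into $P$ and $v$ out of $P$. Inverse systems are indexed by non-empty directed preordered sets. A morphism of inverse systems $(f_\mu,\phi):\mathbf X=(X_\lambda,p_{\lambda\lambda'},\Lambda)\to\mathbf Y=(Y_\mu,q_{\mu\mu'},M)$ in a category consists of a function $\phi:M\to\Lambda$ and morphisms $f_\mu:X_{\phi(\mu)}\to Y_\mu$ such that for all $\mu\le\mu'$ there is $\lambda\ge\phi(\mu),\phi(\mu')$ with $f_\mu p_{\phi(\mu)\lambda}=q_{\mu\mu'}f_{\mu'}p_{\phi(\mu')\lambda}$. Two such, $(f_\mu,\phi)$ and $(f'_\mu,\phi')$, are equivalent if for every $\mu$ there is $\lambda\ge\phi(\mu),\phi'(\mu)$ with $f_\mu p_{\phi(\mu)\lambda}=f'_\mu p_{\phi'(\mu)\lambda}$;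 a pro-morphism is an equivalence class. An HPol-expansion of a space $X$ is a pro-morphism $\mathbf p:X\to\mathbf X$ in pro-HTop, with $\mathbf X$ an inverse system in HPol, through which every pro-morphism from $X$ to an inverse system in HPol factors uniquely. A shape morphism $F:X\to Y$ is a class of triples $(\mathbf p,\mathbf q,\mathbf f)$, where $\mathbf p:X\to\mathbf X$ and $\mathbf q:Y\to\mathbf Y$ are HPol-expansions and $\mathbf f:\mathbf X\to\mathbf Y$ is a pro-morphism; $(\mathbf p,\mathbf q,\mathbf f)$ and $(\mathbf p',\mathbf q',\mathbf f')$ are equivalent if $\mathbf j\mathbf f=\mathbf f'\mathbf i$ for the canonical $\mathbf i,\mathbf j$ with $\mathbf i\mathbf p=\mathbf p'$, $\mathbf j\mathbf q=\mathbf q'$; each $\mathbf f$ in such a triple is called a representation of $F$. For $n\ge 0$, $\dim(f_\mu,\phi)\le n$ means that every $\mu\in M$ admits $\lambda\ge\phi(\mu)$ such that $f_\mu p_{\phi(\mu)\lambda}$ factors in HPol through a polyhedron of dimension $\le n$; $\dim\mathbf f\le n$ means that $\mathbf f$ is the class of some $(f_\mu,\phi)$ with $\dim(f_\mu,\phi)\le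 n$; and $\operatorname{sd}F\le n$ means that $F$ has a representation $\mathbf f$ with $\dim\mathbf f\le n$. Theorem. Let $F:X\to Y$ be a shape morphism of topological spaces with $\operatorname{sd}F\le n$. Then there exist a non-empty directed partially ordered set $(N,\le)$ in which every element has only finitely many predecessors (a cofinite directed ordered set), inverse systems $\mathbf X=(X_\nu,p_{\nu\nu'},N)$ and $\mathbf Y=(Y_\nu,q_{\nu\nu'},N)$ in HPol, and a level morphism $(f_\nu):\mathbf X\to\mathbf Y$, that is, morphisms $f_\nu:X_\nu\to Y_\nu$ of HPol with $f_\nu p_{\nu\nu'}=q_{\nu\nu'}f_{\nu'}$ for all $\nu\le\nu'$, such that the pro-morphism $\mathbf f:\mathbf X\to\mathbf Y$ defined by $(f_\nu)$ is a representation of $F$ and, for every $\nu\in N$, the morphism $f_\nu$ factors in HPol through a polyhedron $P$ with $\dim P\le n$. -/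

import Mathlib

open CategoryTheory

universe w v u

namespace ShapeDim

section Pro

variable {C : Type u} [Category.{v} C]

/-- An inverse system `(X_i, p_{i i'}, Λ)` in a category `C` over a (nonempty) directed
preordered set `Λ`; it is a functor from `Λᵒᵖ` to `C`. -/
structure InvSys (C : Type u) [Category.{v} C] where
  Idx : Type w
  [preorder : Preorder Idx]
  [directed : IsDirectedOrder Idx]
  [nonempty : Nonempty Idx]
  functor : Idxᵒᵖ ⥤ C

namespace InvSys

instance (X : InvSys.{w} C) : Preorder X.Idx := X.preorder
instance (X : InvSys.{w} C) : IsDirectedOrder X.Idx := X.directed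
instance (X : InvSys.{w} C) : Nonempty X.Idx := X.nonempty

/-- The term `X_i`. -/
def obj (X : InvSys.{w} C) (i : X.Idx) : C := X.functor.obj (Opposite.op i)

/-- The bonding morphism `p_{i j} : X_j ⟶ X_i`, for `i ≤ j`. -/
def bond (X : InvSys.{w} C) {i j : X.Idx} (h : i ≤ j) : X.obj j ⟶ X.obj i :=
  X.functor.map (homOfLE h).op

theorem bond_refl (X : InvSys.{w} C) (i : X.Idx) : X.bond (le_refl i) = 𝟙 (X.obj i) :=
  X.functor.map_id _

theorem bond_comp (X : InvSys.{w} C) {i j k : X.Idx} (h : i ≤ j) (h' : j ≤ k) :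
    X.bond h' ≫ X.bond h = X.bond (h.trans h') :=
  (X.functor.map_comp (homOfLE h').op (homOfLE h).op).symm

theorem bond_comp_assoc (X : InvSys.{w} C) {i j k : X.Idx} (h : i ≤ j) (h' : j ≤ k)
    {Z : C} (f : X.obj i ⟶ Z) :
    X.bond h' ≫ X.bond h ≫ f = X.bond (h.trans h') ≫ f := by
  rw [← Category.assoc, bond_comp]

/-- The rudimentary system, whose only term is the given object. -/
abbrev single (A : C) : InvSys.{w} C where
  Idx := PUnit
  functor := (Functor.const _).obj A

/-- A morphism of inverse systems `(f_μ, φ)`. -/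
@[ext]
structure Mor (X Y : InvSys.{w} C) where
  idx : Y.Idx → X.Idx
  app : ∀ m, X.obj (idx m) ⟶ Y.obj m
  comm : ∀ {m m' : Y.Idx} (h : m ≤ m'), ∃ (l : X.Idx) (h₁ : idx m ≤ l) (h₂ : idx m' ≤ l),
    X.bond h₁ ≫ app m = X.bond h₂ ≫ app m' ≫ Y.bond h

namespace Mor

/-- The morphism `f_{μ l} = f_μ ∘ p_{φ(μ) l}`, for `l ≥ φ(μ)`. -/
def appAt {X Y : InvSys.{w} C} (f : Mor X Y) (m : Y.Idx) {l : X.Idx} (h : f.idx m ≤ l) :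
    X.obj l ⟶ Y.obj m :=
  X.bond h ≫ f.app m

theorem bond_appAt {X Y : InvSys.{w} C} (f : Mor X Y) (m : Y.Idx) {l l' : X.Idx}
    (h : f.idx m ≤ l) (h' : l ≤ l') : X.bond h' ≫ f.appAt m h = f.appAt m (h.trans h') :=
  X.bond_comp_assoc h h' _

/-- The equivalence `(f_μ, φ) ∼ (f'_μ, φ')` of morphisms of inverse systems. -/
def Equiv {X Y : InvSys.{w} C} (f g : Mor X Y) : Prop :=
  ∀ m, ∃ (l : X.Idx) (h₁ : f.idx m ≤ l) (h₂ : g.idx m ≤ l), f.appAt m h₁ = g.appAt m h₂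

theorem equiv_equivalence (X Y : InvSys.{w} C) : Equivalence (Equiv (X := X) (Y := Y)) where
  refl f m := ⟨f.idx m, le_refl _, le_refl _, rfl⟩
  symm h m := by
    obtain ⟨l, h₁, h₂, e⟩ := h m
    exact ⟨l, h₂, h₁, e.symm⟩
  trans {f g k} h h' m := by
    obtain ⟨l, h₁, h₂, e⟩ := h m
    obtain ⟨l', h₁', h₂', e'⟩ := h' m
    obtain ⟨l'', a, b⟩ := exists_ge_ge l l'
    refine ⟨l'', h₁.trans a, h₂'.trans b, ?_⟩
    rw [← f.bond_appAt m h₁ a, e, ← k.bond_appAt m h₂' b, ← e', bond_appAt, bond_appAt]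

instance setoid (X Y : InvSys.{w} C) : Setoid (Mor X Y) := ⟨Equiv, equiv_equivalence X Y⟩

/-- The identity morphism. -/
def id (X : InvSys.{w} C) : Mor X X where
  idx := fun i => i
  app i := 𝟙 _
  comm {m m'} h := ⟨m', h, le_refl _, by simp [bond_refl]⟩

/-- The composite of `(f_μ, φ)` and `(g_ν, ψ)` is `(g_ν ∘ f_{ψ(ν)}, φ ∘ ψ)`. -/
def comp {X Y Z : InvSys.{w} C} (f : Mor X Y) (g : Mor Y Z) : Mor X Z where
  idx := fun k => f.idx (g.idx k)
  app k := f.app (g.idx k) ≫ g.app k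
  comm {k k'} h := by
    obtain ⟨m, a, b, e⟩ := g.comm h
    obtain ⟨l₁, a₁, b₁, e₁⟩ := f.comm a
    obtain ⟨l₂, a₂, b₂, e₂⟩ := f.comm b
    obtain ⟨l, c₁, c₂⟩ := exists_ge_ge l₁ l₂
    refine ⟨l, a₁.trans c₁, a₂.trans c₂, ?_⟩
    have e₁' := congrArg (fun t => X.bond c₁ ≫ t ≫ g.app k) e₁
    have e₂' := congrArg (fun t => X.bond c₂ ≫ t ≫ g.app k' ≫ Z.bond h) e₂
    simp only [Category.assoc, bond_comp_assoc] at e₁' e₂' ⊢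
    rw [e₁', e₂', e]

theorem comp_equiv {X Y Z : InvSys.{w} C} {f f' : Mor X Y} {g g' : Mor Y Z}
    (hf : Equiv f f') (hg : Equiv g g') : Equiv (f.comp g) (f'.comp g') := by
  intro k
  obtain ⟨m, a, b, e⟩ := hg k
  obtain ⟨l₀, a₀, b₀, e₀⟩ := hf m
  obtain ⟨l₁, a₁, b₁, e₁⟩ := f.comm a
  obtain ⟨l₂, a₂, b₂, e₂⟩ := f'.comm b
  obtain ⟨l₃, c₀, c₁⟩ := exists_ge_ge l₀ l₁
  obtain ⟨l, c, c₂⟩ := exists_ge_ge l₃ l₂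
  refine ⟨l, a₁.trans (c₁.trans c), a₂.trans c₂, ?_⟩
  have e₀' := congrArg (fun t => X.bond (c₀.trans c) ≫ t ≫ Y.bond b ≫ g'.app k) e₀
  have e₁' := congrArg (fun t => X.bond (c₁.trans c) ≫ t ≫ g.app k) e₁
  have e₂' := congrArg (fun t => X.bond c₂ ≫ t ≫ g'.app k) e₂
  simp only [appAt, comp, Category.assoc, bond_comp_assoc] at e e₀' e₁' e₂' ⊢
  rw [e₁', e₂', e, e₀']

theorem id_comp_equiv {X Y : InvSys.{w} C} (f : Mor X Y) : Equiv ((id X).comp f) f := fun m =>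
  ⟨f.idx m, le_refl _, le_refl _, by simp [appAt, comp, id]⟩

theorem comp_id_equiv {X Y : InvSys.{w} C} (f : Mor X Y) : Equiv (f.comp (id Y)) f := fun m =>
  ⟨f.idx m, le_refl _, le_refl _, by simp [appAt, comp, id]⟩

theorem assoc_equiv {W X Y Z : InvSys.{w} C} (f : Mor W X) (g : Mor X Y) (h : Mor Y Z) :
    Equiv ((f.comp g).comp h) (f.comp (g.comp h)) := fun m =>
  ⟨f.idx (g.idx (h.idx m)), le_refl _, le_refl _, by simp [appAt, comp]⟩

end Mor

/-- The category pro-`C`: inverse systems in `C`, with equivalence classes of morphisms of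
inverse systems (pro-morphisms). -/
instance : Category (InvSys.{w} C) where
  Hom X Y := _root_.Quotient (Mor.setoid X Y)
  id X := _root_.Quotient.mk _ (Mor.id X)
  comp f g := _root_.Quotient.map₂ Mor.comp
    (fun _ _ hf _ _ hg => Mor.comp_equiv hf hg) f g
  id_comp f := _root_.Quotient.inductionOn f fun f => _root_.Quotient.sound (Mor.id_comp_equiv f)
  comp_id f := _root_.Quotient.inductionOn f fun f => _root_.Quotient.sound (Mor.comp_id_equiv f)
  assoc f g h := _root_.Quotient.inductionOn₃ f g h fun f g h =>
    _root_.Quotient.sound (Mor.assoc_equiv f g h)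

/-- The pro-morphism represented by a morphism of inverse systems. -/
def Mor.toPro {X Y : InvSys.{w} C} (f : Mor X Y) : X ⟶ Y := _root_.Quotient.mk (Mor.setoid X Y) f

/-- The inverse system given by a functor on a directed preordered set. -/
abbrev of (N : Type w) [Preorder N] [IsDirectedOrder N] [Nonempty N] (X : Nᵒᵖ ⥤ C) :
    InvSys.{w} C where
  Idx := N
  functor := X

/-- A level morphism `(f_ν)` between inverse systems over the same index set `N`, i.e. a family
with `f_ν ∘ p_{ν ν'} = q_{ν ν'} ∘ f_ν'` for `ν ≤ ν'` (a natural transformation), seen as a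
morphism of inverse systems whose index function is the identity. -/
def levelMor {N : Type w} [Preorder N] [IsDirectedOrder N] [Nonempty N] {X Y : Nᵒᵖ ⥤ C}
    (f : X ⟶ Y) : Mor (of N X) (of N Y) where
  idx := fun i => i
  app i := f.app (Opposite.op i)
  comm {m m'} h := ⟨m', h, le_refl _, by
    rw [bond_refl]
    exact (f.naturality (homOfLE h).op).trans (Category.id_comp _).symm⟩

end InvSys

end Pro

section Polyhedra

/-- The underlying set of the carrier `|K|` of a simplicial complex `K`, in barycentric
coordinates. -/
def Carrier {V : Type u} (K : AbstractSimplicialComplex V) : Type u :=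
  {t : V →₀ ℝ // (∀ x, 0 ≤ t x) ∧ t.support ∈ K.faces ∧ (t.sum fun _ a => a) = 1}

open Classical in
/-- The inclusion of the closed simplex spanned by a face. -/
noncomputable def simplexMap {V : Type u} (K : AbstractSimplicialComplex V) (s : Finset V)
    (hs : s ∈ K.faces) (t : stdSimplex ℝ s) : Carrier K :=
  let c : V → ℝ := fun x => if h : x ∈ s then t.1 ⟨x, h⟩ else 0
  have hc : ∀ x, c x ≠ 0 → x ∈ s := fun x hx => by
    by_contra h
    exact hx (dif_neg h)
  have hsum : ((Finsupp.onFinset s c hc).sum fun _ a => a) = 1 := by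
    rw [Finsupp.onFinset_sum _ (fun _ => rfl), ← Finset.sum_coe_sort, ← t.2.2]
    exact Finset.sum_congr rfl fun x _ => dif_pos x.2
  ⟨Finsupp.onFinset s c hc, by
    refine ⟨fun x => ?_, ?_, hsum⟩
    · change 0 ≤ c x
      by_cases h : x ∈ s
      · simpa [c, h] using t.2.1 ⟨x, h⟩
      · simp [c, h]
    · refine (K.isRelLowerSet_faces hs).2 Finsupp.support_onFinset_subset ?_
      rw [Finsupp.support_nonempty_iff]
      intro h0
      rw [h0] at hsum
      simp at hsum⟩

/-- The weak (CW) topology on `|K|`: a set is open iff its trace on each closed simplex is. -/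
noncomputable instance {V : Type u} (K : AbstractSimplicialComplex V) : TopologicalSpace (Carrier K) :=
  ⨆ (s : Finset V) (hs : s ∈ K.faces), TopologicalSpace.coinduced (simplexMap K s hs) inferInstance

/-- `dim K ≤ n`: each simplex of `K` has dimension at most `n`. -/
def ComplexDimLE {V : Type u} (K : AbstractSimplicialComplex V) (n : ℕ) : Prop :=
  ∀ s ∈ K.faces, s.card ≤ n + 1

/-- The homotopy relation on continuous maps. -/
def homotopyRel : HomRel TopCat.{u} := fun _ _ f g => f.hom.Homotopic g.hom

instance : Congruence homotopyRel.{u} where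
  comp_left f _ _ h := by exact h.comp (ContinuousMap.Homotopic.refl f.hom)
  comp_right g h := by exact (ContinuousMap.Homotopic.refl g.hom).comp h
  equivalence := ⟨fun _ => ContinuousMap.Homotopic.refl _, fun h => h.symm, fun h h' => h.trans h'⟩

/-- The homotopy category of topological spaces; its morphisms are the homotopy classes of
continuous maps (H-maps). -/
abbrev HTop := CategoryTheory.Quotient homotopyRel.{u}

/-- A topological space as an object of `HTop`. -/
abbrev HTop.of (X : TopCat.{u}) : HTop.{u} := (CategoryTheory.Quotient.functor homotopyRel).obj X

/-- The polyhedron `|K|`, as an object of `HTop`. -/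
noncomputable abbrev polyhedron {V : Type u} (K : AbstractSimplicialComplex V) : HTop.{u} :=
  HTop.of (TopCat.of (Carrier K))

/-- The objects of the full subcategory `HPol` of `HTop`: the spaces which have the homotopy type
of a polyhedron. -/
def HPol : ObjectProperty HTop.{u} := fun X =>
  ∃ (V : Type u) (K : AbstractSimplicialComplex V),
    Nonempty (ContinuousMap.HomotopyEquiv X.as (Carrier K))

/-- An H-map factors through a polyhedron of dimension at most `n`. (For a source and target in
`HPol` this is a factorization in the full subcategory `HPol`.) -/
def FactorsThroughDimLE (n : ℕ) {A B : HTop.{u}} (f : A ⟶ B) : Prop :=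
  ∃ (V : Type u) (K : AbstractSimplicialComplex V) (a : A ⟶ polyhedron K) (b : polyhedron K ⟶ B),
    ComplexDimLE K n ∧ a ≫ b = f

end Polyhedra

section Shape

/-- Inverse systems in `HTop`; with the pro-morphisms they form the category pro-`HTop`. -/
abbrev ProHTop := InvSys.{u} HTop.{u}

/-- `X` is an inverse system in `HPol`. (pro-`HPol` is the full subcategory of pro-`HTop` on
these systems.) -/
def IsProHPol (X : ProHTop.{u}) : Prop := ∀ i, HPol (X.obj i)

/-- `p` is an `HPol`-expansion of the space `A`: a morphism of pro-`HTop` from `A` to a system in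
`HPol` through which each morphism from `A` to a system in `HPol` factors uniquely. -/
structure IsHPolExpansion {A : TopCat.{u}} {X : ProHTop.{u}}
    (p : InvSys.single (HTop.of A) ⟶ X) : Prop where
  proHPol : IsProHPol X
  universal : ∀ (Y : ProHTop.{u}), IsProHPol Y → ∀ h : InvSys.single (HTop.of A) ⟶ Y,
    ∃! f : X ⟶ Y, p ≫ f = h

/-- A triple `(p, q, f)` of `HPol`-expansions `p : A ⟶ X`, `q : B ⟶ Y` and a morphism `f : X ⟶ Y`
of pro-`HPol`; such triples represent the shape morphisms from `A` to `B`. -/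
structure ShapeTriple (A B : TopCat.{u}) where
  {X : ProHTop.{u}}
  {Y : ProHTop.{u}}
  p : InvSys.single (HTop.of A) ⟶ X
  q : InvSys.single (HTop.of B) ⟶ Y
  isExpansion_p : IsHPolExpansion p
  isExpansion_q : IsHPolExpansion q
  f : X ⟶ Y

/-- The triples `(p, q, f)` and `(p', q', f')` are equivalent when `j f = f' i`, where `i` and `j`
are the canonical morphisms, those with `i p = p'` and `j q = q'`. -/
def ShapeTriple.Equiv {A B : TopCat.{u}} (S T : ShapeTriple A B) : Prop :=
  ∃ (i : S.X ⟶ T.X) (j : S.Y ⟶ T.Y), S.p ≫ i = T.p ∧ S.q ≫ j = T.q ∧ S.f ≫ j = i ≫ T.f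

theorem IsHPolExpansion.hom_ext {A : TopCat.{u}} {X : ProHTop.{u}}
    {p : InvSys.single (HTop.of A) ⟶ X} (hp : IsHPolExpansion p) {Y : ProHTop.{u}}
    (hY : IsProHPol Y) {f g : X ⟶ Y} (h : p ≫ f = p ≫ g) : f = g :=
  (hp.universal Y hY (p ≫ g)).unique h rfl

theorem ShapeTriple.equiv_equivalence (A B : TopCat.{u}) :
    Equivalence (ShapeTriple.Equiv (A := A) (B := B)) where
  refl S := ⟨𝟙 _, 𝟙 _, by simp⟩
  symm {S T} h := by
    obtain ⟨i, j, hi, hj, e⟩ := h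
    obtain ⟨i', hi', -⟩ := T.isExpansion_p.universal _ S.isExpansion_p.proHPol S.p
    obtain ⟨j', hj', -⟩ := T.isExpansion_q.universal _ S.isExpansion_q.proHPol S.q
    have hji : j ≫ j' = 𝟙 _ := S.isExpansion_q.hom_ext S.isExpansion_q.proHPol (by
      rw [← Category.assoc, hj, hj', Category.comp_id])
    have hii : i' ≫ i = 𝟙 _ := T.isExpansion_p.hom_ext T.isExpansion_p.proHPol (by
      rw [← Category.assoc, hi', hi, Category.comp_id])
    refine ⟨i', j', hi', hj', ?_⟩
    calc T.f ≫ j' = (i' ≫ i) ≫ T.f ≫ j' := by rw [hii, Category.id_comp]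
      _ = i' ≫ (i ≫ T.f) ≫ j' := by simp only [Category.assoc]
      _ = i' ≫ S.f ≫ j ≫ j' := by rw [← e, Category.assoc]
      _ = i' ≫ S.f := by rw [hji, Category.comp_id]
  trans {S T U} h h' := by
    obtain ⟨i, j, hi, hj, e⟩ := h
    obtain ⟨i', j', hi', hj', e'⟩ := h'
    refine ⟨i ≫ i', j ≫ j', by rw [← Category.assoc, hi, hi'], by rw [← Category.assoc, hj, hj'], ?_⟩
    rw [← Category.assoc, e, Category.assoc, e', Category.assoc]

instance ShapeTriple.setoid (A B : TopCat.{u}) : Setoid (ShapeTriple A B) :=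
  ⟨ShapeTriple.Equiv, ShapeTriple.equiv_equivalence A B⟩

/-- Shape morphisms from `A` to `B`: the morphisms of the shape category `Sh(HTop, HPol)`. -/
def ShapeMor (A B : TopCat.{u}) : Type (u + 1) := _root_.Quotient (ShapeTriple.setoid A B)

/-- The pro-morphism `f`, together with the expansions `p` and `q`, represents the shape
morphism `F`. -/
def Represents {A B : TopCat.{u}} {X Y : ProHTop.{u}} (p : InvSys.single (HTop.of A) ⟶ X)
    (q : InvSys.single (HTop.of B) ⟶ Y) (f : X ⟶ Y) (F : ShapeMor A B) : Prop :=
  ∃ (hp : IsHPolExpansion p) (hq : IsHPolExpansion q),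
    _root_.Quotient.mk (ShapeTriple.setoid A B) ⟨p, q, hp, hq, f⟩ = F

/-- `dim (f_μ, φ) ≤ n`, for a morphism of inverse systems. -/
def MorDimLE {X Y : ProHTop.{u}} (f : InvSys.Mor X Y) (n : ℕ) : Prop :=
  ∀ m : Y.Idx, ∃ (l : X.Idx) (h : f.idx m ≤ l), FactorsThroughDimLE n (f.appAt m h)

/-- `dim f ≤ n`, for a pro-morphism. -/
def ProDimLE {X Y : ProHTop.{u}} (f : X ⟶ Y) (n : ℕ) : Prop :=
  ∃ g : InvSys.Mor X Y, g.toPro = f ∧ MorDimLE g n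

/-- `sd F ≤ n`, for a shape morphism. -/
def ShapeDimLE {A B : TopCat.{u}} (F : ShapeMor A B) (n : ℕ) : Prop :=
  ∃ (X Y : ProHTop.{u}) (p : InvSys.single (HTop.of A) ⟶ X) (q : InvSys.single (HTop.of B) ⟶ Y)
    (f : X ⟶ Y), Represents p q f F ∧ ProDimLE f n

end Shape

end ShapeDim

namespace ShapeDim

/-! Represent `F` by a morphism `g = (f_μ, φ)` of dimension at most `n`. The new indices are the
pairs (λ, μ) with λ ≥ φ(μ) for which f_μ p_{φ(μ)λ} already factors through dimension at most `n`
(`LevelIndex`); the order on pairs also demands that the square between the two morphisms commutes,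
so these morphisms form a level morphism by construction. Factoring survives precomposition, so λ
may be increased at will; hence the pairs are directed and both projections are cofinal.

The pairs need not be antisymmetric nor have finitely many predecessors, so they are indexed in turn
by their finite subsets (`exists_monotone_finset_cofinal`). Restricting a system along a monotone
cofinal map is an isomorphism of pro-systems (`isIso_toReindex`). The expansions therefore carry
over, and the level morphism still represents `F` (`toPro_comp_toReindex`). -/

/-- A directed preorder receives a monotone cofinal map from the poset of its finite subsets. -/
theorem exists_monotone_finset_cofinal (T : Type u) [Preorder T] [IsDirectedOrder T] [Nonempty T] :
    ∃ π : Finset T →o T, ∀ t, ∃ s, t ≤ π s := by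
  classical
  have ub : ∀ s : Finset T, ∃ M, ∀ t ∈ s, t ≤ M := fun s => s.exists_le
  choose b hb using ub
  -- The value at `s` bounds the elements of `s`, which gives cofinality through singletons, and the
  -- values at all proper subsets of `s`, which gives monotonicity.
  let π : Finset T → T := Finset.strongInduction fun s φ =>
    b (s ∪ s.ssubsets.attach.image fun r => φ r.1 (Finset.mem_ssubsets.1 r.2))
  have hπ : ∀ s, π s = b (s ∪ s.ssubsets.attach.image fun r => π r.1) := fun s =>
    Finset.strongInduction_eq _ s
  have mono : Monotone π := fun r s hrs => by
    rcases eq_or_lt_of_le hrs with rfl | hlt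
    · exact le_rfl
    · rw [hπ s]
      exact hb _ _ (Finset.mem_union_right _
        (Finset.mem_image.2 ⟨⟨r, Finset.mem_ssubsets.2 hlt⟩, Finset.mem_attach _ _, rfl⟩))
  refine ⟨⟨π, mono⟩, fun t => ⟨{t}, ?_⟩⟩
  change t ≤ π {t}
  rw [hπ]
  exact hb _ _ (Finset.mem_union_left _ (Finset.mem_singleton_self t))

/-! ### Restriction of inverse systems along monotone cofinal maps -/

namespace InvSys

variable {C : Type u} [Category.{v} C]

/-- The restriction of an inverse system along a monotone map of index sets. -/
abbrev reindexFunctor (X : InvSys.{w} C) {N : Type w} [Preorder N] (π : N →o X.Idx) : Nᵒᵖ ⥤ C :=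
  π.monotone.functor.op ⋙ X.functor

section Reindex

variable (X : InvSys.{w} C) {N : Type w} [Preorder N] [IsDirectedOrder N] [Nonempty N]
  (π : N →o X.Idx)

/-- The restriction morphism from a system to its reindexing. -/
def toReindex : Mor X (of N (X.reindexFunctor π)) where
  idx := π
  app i := 𝟙 (X.obj (π i))
  comm {m m'} h := ⟨π m', π.monotone h, le_rfl, by
    change X.bond (π.monotone h) ≫ 𝟙 (X.obj (π m)) =
      X.bond (le_refl (π m')) ≫ 𝟙 (X.obj (π m')) ≫ X.bond (π.monotone h)
    rw [bond_refl, Category.comp_id, Category.id_comp, Category.id_comp]⟩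

/-- The morphism back from a reindexing along a cofinal map. -/
def ofReindex (σ : X.Idx → N) (hσ : ∀ i, i ≤ π (σ i)) : Mor (of N (X.reindexFunctor π)) X where
  idx := σ
  app i := X.bond (hσ i)
  comm {m m'} h := by
    -- `σ` need not be monotone: over any common upper bound both sides are the same bonding
    -- morphism.
    obtain ⟨l, a, b⟩ := exists_ge_ge (σ m) (σ m')
    refine ⟨l, a, b, ?_⟩
    change X.bond (π.monotone a) ≫ X.bond (hσ m) =
      X.bond (π.monotone b) ≫ X.bond (hσ m') ≫ X.bond h
    simp only [bond_comp]

theorem toReindex_comp_ofReindex (σ : X.Idx → N) (hσ : ∀ i, i ≤ π (σ i)) :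
    (X.toReindex π).toPro ≫ (X.ofReindex π σ hσ).toPro = 𝟙 X :=
  _root_.Quotient.sound fun i => ⟨π (σ i), le_rfl, hσ i, by
    change X.bond (le_refl (π (σ i))) ≫ 𝟙 (X.obj (π (σ i))) ≫ X.bond (hσ i) =
      X.bond (hσ i) ≫ 𝟙 (X.obj i)
    rw [bond_refl, Category.comp_id, Category.id_comp, Category.id_comp]⟩

theorem ofReindex_comp_toReindex (σ : X.Idx → N) (hσ : ∀ i, i ≤ π (σ i)) :
    (X.ofReindex π σ hσ).toPro ≫ (X.toReindex π).toPro = 𝟙 (of N (X.reindexFunctor π)) :=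
  _root_.Quotient.sound fun i => by
    obtain ⟨l, a, b⟩ := exists_ge_ge (σ (π i)) i
    refine ⟨l, a, b, ?_⟩
    change X.bond (π.monotone a) ≫ X.bond (hσ (π i)) ≫ 𝟙 (X.obj (π i)) =
      X.bond (π.monotone b) ≫ 𝟙 (X.obj (π i))
    simp only [Category.comp_id, bond_comp]

/-- A system is isomorphic, in pro-`C`, to its reindexing along a monotone cofinal map. -/
theorem isIso_toReindex (hπ : ∀ i, ∃ j, i ≤ π j) : IsIso (X.toReindex π).toPro := by
  choose σ hσ using hπ
  exact ⟨(X.ofReindex π σ hσ).toPro, X.toReindex_comp_ofReindex π σ hσ,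
    X.ofReindex_comp_toReindex π σ hσ⟩

end Reindex

/-! ### Straightening a morphism of systems to a level morphism -/

variable {X Y : InvSys.{w} C}

/-- The pairs of indices `idx m ≤ l` for which the morphism `g.appAt m : X_l ⟶ Y_m` has a given
property `P`. -/
structure Mor.LevelIndex (g : Mor X Y) (P : MorphismProperty C) where
  src : X.Idx
  tgt : Y.Idx
  le : g.idx tgt ≤ src
  prop : P (g.appAt tgt le)

namespace Mor.LevelIndex

variable {g : Mor X Y} {P : MorphismProperty C}

/-- Pairs are compared when both indices are and the resulting square commutes. -/
instance : Preorder (g.LevelIndex P) where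
  le s t := ∃ (h : s.src ≤ t.src) (k : s.tgt ≤ t.tgt),
    X.bond h ≫ g.appAt s.tgt s.le = g.appAt t.tgt t.le ≫ Y.bond k
  le_refl s := ⟨le_rfl, le_rfl, by
    rw [bond_refl, bond_refl, Category.id_comp, Category.comp_id]⟩
  le_trans r s t := by
    rintro ⟨h, k, e⟩ ⟨h', k', e'⟩
    exact ⟨h.trans h', k.trans k', by
      rw [← X.bond_comp h h', Category.assoc, e, ← Category.assoc, e', Category.assoc, bond_comp]⟩

/-- The first projection. -/
def srcHom : g.LevelIndex P →o X.Idx := ⟨src, fun _ _ h => h.1⟩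

/-- The second projection. -/
def tgtHom : g.LevelIndex P →o Y.Idx := ⟨tgt, fun _ _ h => h.2.1⟩

/-- Enlarging the source index precomposes with a bonding morphism, which preserves `P`. This gives
the cofinality of both projections and the freedom used for directedness. -/
theorem exists_ge (hP : ∀ {A B D : C} (a : A ⟶ B) (b : B ⟶ D), P b → P (a ≫ b))
    (hg : ∀ m, ∃ (l : X.Idx) (h : g.idx m ≤ l), P (g.appAt m h)) (l₀ : X.Idx) (m : Y.Idx) :
    ∃ t : g.LevelIndex P, t.tgt = m ∧ l₀ ≤ t.src := by
  obtain ⟨l, h, hl⟩ := hg m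
  obtain ⟨l', a, b⟩ := exists_ge_ge l l₀
  exact ⟨⟨l', m, h.trans a, g.bond_appAt m h a ▸ hP _ _ hl⟩, rfl, b⟩

theorem nonempty (hP : ∀ {A B D : C} (a : A ⟶ B) (b : B ⟶ D), P b → P (a ≫ b))
    (hg : ∀ m, ∃ (l : X.Idx) (h : g.idx m ≤ l), P (g.appAt m h)) :
    Nonempty (g.LevelIndex P) :=
  ⟨(exists_ge hP hg (Classical.arbitrary _) (Classical.arbitrary _)).choose⟩

theorem isDirectedOrder (hP : ∀ {A B D : C} (a : A ⟶ B) (b : B ⟶ D), P b → P (a ≫ b))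
    (hg : ∀ m, ∃ (l : X.Idx) (h : g.idx m ≤ l), P (g.appAt m h)) :
    IsDirectedOrder (g.LevelIndex P) where
  directed s t := by
    -- A square that commutes over `l` commutes over every larger source index.
    have key : ∀ (r u : g.LevelIndex P) (k : r.tgt ≤ u.tgt) (l : X.Idx) (c : g.idx r.tgt ≤ l)
        (d : g.idx u.tgt ≤ l), X.bond c ≫ g.app r.tgt = X.bond d ≫ g.app u.tgt ≫ Y.bond k →
        l ≤ u.src → r.src ≤ u.src → r ≤ u := by
      intro r u k l c d e hl hr
      refine ⟨hr, k, ?_⟩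
      have e' := congrArg (X.bond hl ≫ ·) e
      simp only [bond_comp_assoc] at e'
      rw [g.bond_appAt, appAt, e', appAt, Category.assoc]
    obtain ⟨m, k₁, k₂⟩ := exists_ge_ge s.tgt t.tgt
    obtain ⟨l₁, c₁, d₁, e₁⟩ := g.comm k₁
    obtain ⟨l₂, c₂, d₂, e₂⟩ := g.comm k₂
    obtain ⟨l₃, a₁, a₂⟩ := exists_ge_ge l₁ l₂
    obtain ⟨l₄, b₁, b₂⟩ := exists_ge_ge s.src t.src
    obtain ⟨l, f₃, f₄⟩ := exists_ge_ge l₃ l₄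
    -- The target must be exactly `m`, for which the two squares were found; only the source is
    -- pushed further.
    obtain ⟨u, rfl, hu⟩ := exists_ge hP hg l m
    exact ⟨u, key s u k₁ l₁ c₁ d₁ e₁ (a₁.trans (f₃.trans hu)) (b₁.trans (f₄.trans hu)),
      key t u k₂ l₂ c₂ d₂ e₂ (a₂.trans (f₃.trans hu)) (b₂.trans (f₄.trans hu))⟩

/-- The level morphism formed by the morphisms `g.appAt`. -/
def levelHom {N : Type w} [Preorder N] (π : N →o g.LevelIndex P) :
    X.reindexFunctor (srcHom.comp π) ⟶ Y.reindexFunctor (tgtHom.comp π) where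
  app i := g.appAt (π i.unop).tgt (π i.unop).le
  -- Naturality is the commuting square built into the order on pairs.
  naturality _ _ k := (π.monotone k.unop.le).2.2

/-- The restriction morphisms consist of identities, so both composites are given by `g.appAt` over
the source of `π i`. -/
theorem toPro_comp_toReindex {N : Type w} [Preorder N] [IsDirectedOrder N] [Nonempty N]
    (π : N →o g.LevelIndex P) :
    g.toPro ≫ (Y.toReindex (tgtHom.comp π)).toPro =
      (X.toReindex (srcHom.comp π)).toPro ≫ (levelMor (levelHom π)).toPro :=
  _root_.Quotient.sound fun i => ⟨(π i).src, (π i).le, le_rfl, by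
    change X.bond (π i).le ≫ g.app (π i).tgt ≫ 𝟙 (Y.obj (π i).tgt) =
      X.bond (le_refl (π i).src) ≫ 𝟙 (X.obj (π i).src) ≫ g.appAt (π i).tgt (π i).le
    rw [bond_refl, Category.comp_id, Category.id_comp, Category.id_comp, appAt]⟩

end Mor.LevelIndex

end InvSys

/-! ### Transfer to expansions and dimension -/

theorem IsHPolExpansion.comp_isIso {A : TopCat.{u}} {X X' : ProHTop.{u}}
    {p : InvSys.single (HTop.of A) ⟶ X} (hp : IsHPolExpansion p) (i : X ⟶ X') [IsIso i]
    (hX' : IsProHPol X') : IsHPolExpansion (p ≫ i) where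
  proHPol := hX'
  universal Y hY h := by
    obtain ⟨f, hf, -⟩ := hp.universal Y hY h
    refine ⟨inv i ≫ f, by simpa using hf, fun f' hf' => ?_⟩
    rw [IsIso.eq_inv_comp]
    exact hp.hom_ext hY (by rw [hf, ← hf', Category.assoc])

theorem FactorsThroughDimLE.precomp {n : ℕ} {A B D : HTop.{u}} (a : A ⟶ B) (b : B ⟶ D)
    (hb : FactorsThroughDimLE n b) : FactorsThroughDimLE n (a ≫ b) := by
  obtain ⟨V, K, c, d, hK, rfl⟩ := hb
  exact ⟨V, K, a ≫ c, d, hK, Category.assoc _ _ _⟩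

end ShapeDim

theorem theorem3 {A B : TopCat.{u}} (n : ℕ) (F : ShapeDim.ShapeMor A B)
    (hF : ShapeDim.ShapeDimLE F n) :
    ∃ (N : Type u) (_ : PartialOrder N) (_ : IsDirectedOrder N) (_ : Nonempty N),
      (∀ i : N, (Set.Iic i).Finite) ∧
      ∃ (X Y : Nᵒᵖ ⥤ ShapeDim.HTop.{u}) (f : X ⟶ Y)
        (p : ShapeDim.InvSys.single (ShapeDim.HTop.of A) ⟶ ShapeDim.InvSys.of N X)
        (q : ShapeDim.InvSys.single (ShapeDim.HTop.of B) ⟶ ShapeDim.InvSys.of N Y),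
        ShapeDim.IsProHPol (ShapeDim.InvSys.of N X) ∧
        ShapeDim.IsProHPol (ShapeDim.InvSys.of N Y) ∧
        ShapeDim.Represents p q (ShapeDim.InvSys.levelMor f).toPro F ∧
        ∀ i : N, ShapeDim.FactorsThroughDimLE n (f.app (Opposite.op i)) := by
  obtain ⟨X, Y, p, q, f, ⟨hp, hq, hF⟩, g, hgf, hg⟩ := hF
  let P : MorphismProperty ShapeDim.HTop.{u} := fun _ _ h => ShapeDim.FactorsThroughDimLE n h
  have hP : ∀ {A B D : ShapeDim.HTop.{u}} (a : A ⟶ B) (b : B ⟶ D), P b → P (a ≫ b) :=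
    fun a b hb => ShapeDim.FactorsThroughDimLE.precomp a b hb
  have := ShapeDim.InvSys.Mor.LevelIndex.nonempty (g := g) hP hg
  have := ShapeDim.InvSys.Mor.LevelIndex.isDirectedOrder (g := g) hP hg
  obtain ⟨π, hπ⟩ := ShapeDim.exists_monotone_finset_cofinal (g.LevelIndex P)
  let πX := ShapeDim.InvSys.Mor.LevelIndex.srcHom.comp π
  let πY := ShapeDim.InvSys.Mor.LevelIndex.tgtHom.comp π
  have hX : ∀ i, ∃ s, i ≤ πX s := fun i => by
    obtain ⟨t, -, ht⟩ := ShapeDim.InvSys.Mor.LevelIndex.exists_ge (g := g) hP hg i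
      (Classical.arbitrary _)
    obtain ⟨s, hs⟩ := hπ t
    exact ⟨s, ht.trans hs.1⟩
  have hY : ∀ i, ∃ s, i ≤ πY s := fun i => by
    obtain ⟨t, rfl, -⟩ := ShapeDim.InvSys.Mor.LevelIndex.exists_ge (g := g) hP hg
      (Classical.arbitrary _) i
    obtain ⟨s, hs⟩ := hπ t
    exact ⟨s, hs.2.1⟩
  have := X.isIso_toReindex πX hX
  have := Y.isIso_toReindex πY hY
  have polX : ShapeDim.IsProHPol (ShapeDim.InvSys.of _ (X.reindexFunctor πX)) :=
    fun i => hp.proHPol (πX i)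
  have polY : ShapeDim.IsProHPol (ShapeDim.InvSys.of _ (Y.reindexFunctor πY)) :=
    fun i => hq.proHPol (πY i)
  refine ⟨Finset (g.LevelIndex P), inferInstance, inferInstance, inferInstance,
    -- The predecessors of a finite set are its subsets.
    fun i => i.powerset.finite_toSet.subset fun _ hs => Finset.mem_powerset.2 hs, X.reindexFunctor πX, Y.reindexFunctor πY,
    ShapeDim.InvSys.Mor.LevelIndex.levelHom π, p ≫ (X.toReindex πX).toPro,
    q ≫ (Y.toReindex πY).toPro, polX, polY,
    ⟨hp.comp_isIso _ polX, hq.comp_isIso _ polY, ?_⟩, fun i => (π i).prop⟩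
  rw [← hF]
  refine Eq.symm (_root_.Quotient.sound (s := ShapeDim.ShapeTriple.setoid A B) ?_)
  -- The new expansions are the old ones followed by the restrictions, so the restrictions are the
  -- canonical morphisms.
  refine ⟨(X.toReindex πX).toPro, (Y.toReindex πY).toPro, rfl, rfl, ?_⟩
  rw [← hgf]
  exact ShapeDim.InvSys.Mor.LevelIndex.toPro_comp_toReindex π
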